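/- Let $\Lambda=(-1,1)$, $\omega^{(a,b)}(x)=(1-x)^a(1+x)^b$, $\|v\|_{\omega^{(a,b)}}^2=\int_\Lambda v^2\,\omega^{(a,b)}\,dx$ and $\|\cdot\|=\|\cdot\|_{\omega^{(0,0)}}$. For $\rho>0$ let $I_+^{\rho}v(x)=\frac1{\Gamma(\rho)}\int_x^1 (y-x)^{\rho-1}v(y)\,dy$, and for $s\in[k-1,k)$, $k\in\mathbb N$, let $D_+^s v=(-1)^k\frac{d^k}{dx^k}I_+^{k-s}v$ be the right-sided Riemann–Liouville derivative (derivatives being understood in the weak sense on $\Lambda$). Let $P_n^{(\alpha,\beta)}(x)=\sum_{j=0}^n\frac{(n+\alpha+\beta+1)_j(\alpha+j+1)_{n-j}}{j!\,(n-j)!}\big(\frac{x-1}2\big)^j$ be the Jacobi polynomials with real parameters and ${}^+J_n^{(-s,-s)}(x)=(1-x)^sP_n^{(s,-s)}(x)$ the generalized Jacobi functions. For every $m\in\mathbb N_0$ there is a constant $c>0$ depending only on $m$ such that the following holds. Let $k\in\mathbb N$, $s\in(k-1,k)$, $N\ge m$, and let $f\in L^2(\Lambda)$ have weak derivatives $f^{(l)}\in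 L^2_{\omega^{(l,l)}}(\Lambda)$ for all $0\le l\le m$. Let $u$ be a solution of $$D_+^su=f\ \text{ in }\Lambda,\qquad u^{(l)}(1)=0,\quad l=0,\dots,k-1,$$ and let $u_N\in\operatorname{span}\{{}^+J_n^{(-s,-s)}:0\le n\le N\}$ be a solution of the Petrov–Galerkin scheme $$\int_\Lambda (D_+^su_N)\,v\,dx=\int_\Lambda f\,v\,dx\qquad\text{for all real polynomials } v \text{ of degree at most } N.$$ Then $D_+^s(u-u_N)\in L^2(\Lambda)$ and $$\|D_+^s(u-u_N)\|\le c\,N^{-m}\,\|f^{(m)}\|_{\omega^{(m,m)}},$$ and moreover, with a bound that is explicit in both $N$ and $m$, $$\|D_+^s(u-u_N)\|\le N^{-m/2}\sqrt{\frac{(N-m+1)!}{(N+1)!}}\;\|f^{(m)}\|_{\omega^{(m,m)}}$$ (with $0^0=1$ if $m=N=0$). -/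

import Mathlib

open MeasureTheory Filter Topology
open scoped ContDiff

namespace GJF

/-- The interval `Λ = (-1, 1)`. -/
def Lam : Set ℝ := Set.Ioo (-1) 1

/-- The Jacobi weight `ω^{(a,b)}(x) = (1 - x)^a (1 + x)^b`. -/
noncomputable def weight (a b x : ℝ) : ℝ := (1 - x) ^ a * (1 + x) ^ b

/-- Membership in the weighted space `L²_{ω^{(a,b)}}(Λ)`. -/
def MemL2 (a b : ℝ) (v : ℝ → ℝ) : Prop :=
  AEStronglyMeasurable v (volume.restrict Lam) ∧
    IntegrableOn (fun x => v x ^ 2 * weight a b x) Lam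

/-- The norm `‖v‖_{ω^{(a,b)}}` of `L²_{ω^{(a,b)}}(Λ)`. -/
noncomputable def normL2 (a b : ℝ) (v : ℝ → ℝ) : ℝ :=
  Real.sqrt (∫ x in Lam, v x ^ 2 * weight a b x)

/-- `w` is the `n`-th weak (distributional) derivative of `v` on `Λ`. -/
def HasWeakDeriv (n : ℕ) (v w : ℝ → ℝ) : Prop :=
  LocallyIntegrableOn v Lam ∧ LocallyIntegrableOn w Lam ∧
    ∀ φ : ℝ → ℝ, ContDiff ℝ ∞ φ → HasCompactSupport φ → tsupport φ ⊆ Lam →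
      ∫ x in Lam, v x * iteratedDeriv n φ x = (-1) ^ n * ∫ x in Lam, w x * φ x

/-- The right fractional integral
`I_+^ρ v (x) = Γ(ρ)⁻¹ ∫_x^1 v(y) (y - x)^{ρ - 1} dy`, for `ρ > 0`. -/
noncomputable def rightInt (ρ : ℝ) (v : ℝ → ℝ) (x : ℝ) : ℝ :=
  (Real.Gamma ρ)⁻¹ * ∫ y in Set.Ioo x 1, v y * (y - x) ^ (ρ - 1)

/-- `D_+^s v = g` on `Λ`: the right-sided Riemann-Liouville derivative of order `s ∈ [k-1, k)`,
`D_+^s v = (-1)^k D^k I_+^{k-s} v` with `k = ⌊s⌋ + 1`. The derivative `D^k` is understood weakly,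
so `g` is determined up to a null set. -/
def HasRightRL (s : ℝ) (v g : ℝ → ℝ) : Prop :=
  (∀ x ∈ Lam, IntegrableOn v (Set.Ioo x 1)) ∧
    HasWeakDeriv (⌊s⌋₊ + 1) (rightInt ((⌊s⌋₊ + 1 : ℕ) - s) v)
      (fun x => (-1) ^ (⌊s⌋₊ + 1) * g x)

/-- `v^{(l)}(1) = 0`: the `l`-th weak derivative of `v` on `Λ` has a representative that tends
to `0` at the right endpoint. -/
def DerivVanishesAtOne (l : ℕ) (v : ℝ → ℝ) : Prop :=
  ∃ w : ℝ → ℝ, HasWeakDeriv l v w ∧ Tendsto w (𝓝[<] 1) (𝓝 0)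

/-- `u` solves the fractional initial value problem `D_+^s u = f` on `Λ`,
`u^{(l)}(1) = 0` for `0 ≤ l ≤ k - 1`. -/
def IsSolution (k : ℕ) (s : ℝ) (f u : ℝ → ℝ) : Prop :=
  HasRightRL s u f ∧ ∀ l < k, DerivVanishesAtOne l u

/-- The Jacobi polynomial `P_n^{(α,β)}` with arbitrary real parameters,
`∑_j (n+α+β+1)_j (α+j+1)_{n-j} / (j! (n-j)!) ((x-1)/2)^j`. -/
noncomputable def jacobiP (n : ℕ) (α β x : ℝ) : ℝ :=
  ∑ j ∈ Finset.range (n + 1),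
    (ascPochhammer ℝ j).eval (n + α + β + 1) * (ascPochhammer ℝ (n - j)).eval (α + j + 1) /
      (j.factorial * (n - j).factorial) * ((x - 1) / 2) ^ j

/-- The generalized Jacobi function `⁺J_n^{(-α,β)}(x) = (1 - x)^α P_n^{(α,β)}(x)`. The first
parameter is passed as `α`, without the sign. -/
noncomputable def gjf (n : ℕ) (α β x : ℝ) : ℝ := (1 - x) ^ α * jacobiP n α β x

/-- The trial space spanned by `⁺J_n^{(-s,-s)}`, `0 ≤ n ≤ N`. -/
noncomputable def trialSpace (s : ℝ) (N : ℕ) : Submodule ℝ (ℝ → ℝ) :=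
  Submodule.span ℝ {φ | ∃ n ≤ N, φ = gjf n s (-s)}

/-- `uN` solves the Petrov-Galerkin scheme: it lies in the trial space, and
`(D_+^s uN, p) = (f, p)` for all polynomials `p` of degree at most `N`. -/
def IsGalerkin (s : ℝ) (N : ℕ) (f uN : ℝ → ℝ) : Prop :=
  uN ∈ trialSpace s N ∧
    ∃ g : ℝ → ℝ, HasRightRL s uN g ∧ MemL2 0 0 g ∧
      ∀ p : Polynomial ℝ, p.natDegree ≤ N →
        ∫ x in Lam, g x * p.eval x = ∫ x in Lam, f x * p.eval x

end GJF

namespace GJF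

open Polynomial

/-! The fractional derivative turns the scheme into ordinary `L²` projection. A trial function is
`(1 - x) ^ s` times a polynomial of degree at most `N`; its fractional integral of order `k - s` is
a polynomial of degree at most `k + N`, so its derivative of order `s` is a polynomial `p` of degree
at most `N` (`exists_polynomial_of_hasRightRL`). The Galerkin equations then say that `p` is the
orthogonal projection of `f`, and the error is `f - p`.

Put `h_l = f^(l) - p^(l)`. Integration by parts makes `h_l` orthogonal to polynomials of degree at
most `N - l` for the weight `(1 - x ^ 2) ^ l` (`orthogonal_weakDeriv`). A weighted Poincaré
inequality (`integral_sq_le_of_orthogonal`), whose constant is an eigenvalue of the Jacobi operator,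
gives `(N - l + 1) (N + l + 2) ‖h_l‖² ≤ ‖h_(l+1)‖²`. Over `l < m` the first factors multiply to `(N
+ 1)! / (N - m + 1)!` and the second to at least `N ^ m`. Finally `‖h_m‖ ≤ ‖f^(m)‖`, as `p^(m)` is
orthogonal to `h_m`.

The Poincaré inequality is proved without a complete eigenbasis: the operator is inverted on
polynomials, and density passes the bound to the limit. -/

/-! ### Weighted measures and density of polynomials -/

theorem weight_natCast (a : ℕ) (x : ℝ) : weight a a x = (1 - x ^ 2) ^ a := by
  rw [weight, Real.rpow_natCast, Real.rpow_natCast, ← mul_pow]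
  ring

theorem one_sub_sq_pos {x : ℝ} (hx : x ∈ Lam) : 0 < 1 - x ^ 2 := by
  have h1 := hx.1
  have h2 := hx.2
  nlinarith

theorem measurableSet_Lam : MeasurableSet Lam := measurableSet_Ioo

theorem isOpen_Lam : IsOpen Lam := isOpen_Ioo

/-- The measure `(1 - x ^ 2) ^ a dx` on `Λ`. -/
noncomputable def jacobiMeasure (a : ℕ) : Measure ℝ :=
  (volume.restrict Lam).withDensity fun x => ENNReal.ofReal ((1 - x ^ 2) ^ a)

theorem measurable_jacobiDensity (a : ℕ) :
    Measurable fun x : ℝ => ENNReal.ofReal ((1 - x ^ 2) ^ a) := by fun_prop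

theorem ae_jacobiDensity_toReal (a : ℕ) :
    ∀ᵐ x ∂volume.restrict Lam,
      (ENNReal.ofReal ((1 - x ^ 2) ^ a)).toReal = (1 - x ^ 2) ^ a := by
  filter_upwards [ae_restrict_mem measurableSet_Lam] with x hx
  exact ENNReal.toReal_ofReal (pow_pos (one_sub_sq_pos hx) a).le

theorem integral_jacobiMeasure (a : ℕ) (v : ℝ → ℝ) :
    ∫ x, v x ∂jacobiMeasure a = ∫ x in Lam, v x * (1 - x ^ 2) ^ a := by
  rw [jacobiMeasure, integral_withDensity_eq_integral_toReal_smul (measurable_jacobiDensity a)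
    (ae_of_all _ fun x => ENNReal.ofReal_lt_top)]
  refine integral_congr_ae ?_
  filter_upwards [ae_jacobiDensity_toReal a] with x hx
  simp only [hx, smul_eq_mul, mul_comm]

theorem integrable_jacobiMeasure_iff (a : ℕ) (v : ℝ → ℝ) :
    Integrable v (jacobiMeasure a) ↔ IntegrableOn (fun x => v x * (1 - x ^ 2) ^ a) Lam := by
  rw [jacobiMeasure, integrable_withDensity_iff (measurable_jacobiDensity a)
    (ae_of_all _ fun x => ENNReal.ofReal_lt_top), IntegrableOn]
  refine integrable_congr ?_
  filter_upwards [ae_jacobiDensity_toReal a] with x hx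
  simp only [hx]

theorem jacobiMeasure_absolutelyContinuous (a : ℕ) :
    jacobiMeasure a ≪ volume.restrict Lam :=
  withDensity_absolutelyContinuous _ _

theorem absolutelyContinuous_jacobiMeasure (a : ℕ) :
    volume.restrict Lam ≪ jacobiMeasure a := by
  refine withDensity_absolutelyContinuous' (measurable_jacobiDensity a).aemeasurable ?_
  filter_upwards [ae_restrict_mem measurableSet_Lam] with x hx
  simpa using pow_pos (one_sub_sq_pos hx) a

theorem ae_mem_Lam (a : ℕ) : ∀ᵐ x ∂jacobiMeasure a, x ∈ Lam :=
  (jacobiMeasure_absolutelyContinuous a).ae_le (ae_restrict_mem measurableSet_Lam)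

theorem ae_jacobiMeasure_iff (a : ℕ) {P : ℝ → Prop} :
    (∀ᵐ x ∂jacobiMeasure a, P x) ↔ ∀ᵐ x ∂volume.restrict Lam, P x :=
  ⟨fun h => (absolutelyContinuous_jacobiMeasure a).ae_le h,
    fun h => (jacobiMeasure_absolutelyContinuous a).ae_le h⟩

instance isFiniteMeasure_jacobiMeasure (a : ℕ) : IsFiniteMeasure (jacobiMeasure a) := by
  refine isFiniteMeasure_withDensity (ne_of_lt ?_)
  calc ∫⁻ x in Lam, ENNReal.ofReal ((1 - x ^ 2) ^ a) ≤ ∫⁻ _ in Lam, 1 := by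
        refine setLIntegral_mono measurable_const fun x hx => ?_
        rw [← ENNReal.ofReal_one]
        refine ENNReal.ofReal_le_ofReal (pow_le_one₀ (one_sub_sq_pos hx).le ?_)
        nlinarith [sq_nonneg x]
    _ < ⊤ := by simp [Lam]

instance nullSingletonClass_jacobiMeasure (a : ℕ) : NullSingletonClass (jacobiMeasure a) :=
  ⟨fun x => jacobiMeasure_absolutelyContinuous a (measure_singleton x)⟩

theorem jacobiMeasure_ne_zero (a : ℕ) : jacobiMeasure a ≠ 0 := by
  intro h
  have h1 : volume.restrict Lam Set.univ = 0 :=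
    absolutelyContinuous_jacobiMeasure a (by simp [h])
  norm_num [Lam] at h1

theorem memL2_iff (a : ℕ) (v : ℝ → ℝ) : MemL2 a a v ↔ MemLp v 2 (jacobiMeasure a) := by
  simp only [MemL2, weight_natCast]
  constructor
  · rintro ⟨h1, h2⟩
    rw [memLp_two_iff_integrable_sq (h1.mono_ac (jacobiMeasure_absolutelyContinuous a)),
      integrable_jacobiMeasure_iff]
    exact h2
  · intro h
    refine ⟨h.1.mono_ac (absolutelyContinuous_jacobiMeasure a), ?_⟩
    rw [memLp_two_iff_integrable_sq h.1, integrable_jacobiMeasure_iff] at h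
    exact h

theorem normL2_natCast (a : ℕ) (v : ℝ → ℝ) :
    normL2 a a v = Real.sqrt (∫ x, v x ^ 2 ∂jacobiMeasure a) := by
  simp only [normL2, weight_natCast, integral_jacobiMeasure]

theorem exists_bound_eval (p : ℝ[X]) : ∃ C : ℝ, 0 ≤ C ∧ ∀ x ∈ Lam, |p.eval x| ≤ C := by
  obtain ⟨C, hC⟩ := (isCompact_Icc (a := (-1 : ℝ)) (b := 1)).exists_bound_of_continuousOn
    (f := fun x => p.eval x) p.continuous.continuousOn
  have hx : (0 : ℝ) ∈ Set.Icc (-1 : ℝ) 1 := by norm_num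
  exact ⟨C, (norm_nonneg _).trans (hC 0 hx), fun x hx => hC x (Set.Ioo_subset_Icc_self hx)⟩

theorem memLp_eval (a : ℕ) (p : ℝ[X]) : MemLp (fun x => p.eval x) 2 (jacobiMeasure a) := by
  obtain ⟨C, -, hC⟩ := exists_bound_eval p
  refine MemLp.of_bound p.continuous.aestronglyMeasurable C ?_
  filter_upwards [ae_mem_Lam a] with x hx using hC x hx

theorem integrable_mul_eval {a : ℕ} {v : ℝ → ℝ} (hv : MemLp v 2 (jacobiMeasure a)) (p : ℝ[X]) :
    Integrable (fun x => v x * p.eval x) (jacobiMeasure a) :=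
  hv.integrable_mul (memLp_eval a p)

theorem integrable_eval_mul_eval (a : ℕ) (p q : ℝ[X]) :
    Integrable (fun x => p.eval x * q.eval x) (jacobiMeasure a) :=
  integrable_mul_eval (memLp_eval a p) q

/-- A nonzero polynomial has finitely many roots, a null set for a nonzero measure without atoms.
This definiteness drives every "orthogonal to itself" argument below. -/
theorem eq_zero_of_integral_sq_eq_zero {a : ℕ} {p : ℝ[X]}
    (h : ∫ x, p.eval x * p.eval x ∂jacobiMeasure a = 0) : p = 0 := by
  by_contra hp
  rw [integral_eq_zero_iff_of_nonneg (fun x => mul_self_nonneg _)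
    (integrable_eval_mul_eval a p p)] at h
  have hr : ∀ᵐ x ∂jacobiMeasure a, x ∉ p.roots.toFinset :=
    measure_eq_zero_iff_ae_notMem.1 (p.roots.toFinset.finite_toSet.measure_zero _)
  have hF : ∀ᵐ _ ∂jacobiMeasure a, False := by
    filter_upwards [h, hr] with x h1 h2
    apply h2
    simp only [Pi.zero_apply, mul_self_eq_zero] at h1
    simpa [hp] using h1
  rw [ae_iff] at hF
  simp [jacobiMeasure_ne_zero] at hF

/-- Polynomials are dense in the weighted space. -/
theorem exists_polynomial_integral_sq_sub_le {a : ℕ} {h : ℝ → ℝ}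
    (hh : MemLp h 2 (jacobiMeasure a)) {ε : ℝ} (hε : 0 < ε) :
    ∃ r : ℝ[X], ∫ x, (h x - r.eval x) ^ 2 ∂jacobiMeasure a ≤ ε := by
  have h2 : ENNReal.ofReal 2 = 2 := by norm_num
  obtain ⟨g, hg, hgm⟩ := MemLp.exists_boundedContinuous_integral_rpow_sub_le
    (μ := jacobiMeasure a) (p := 2) (by norm_num) (f := h) (by rwa [h2])
    (show (0 : ℝ) < ε / 4 by positivity)
  rw [h2] at hgm
  set V : ℝ := (jacobiMeasure a).real Set.univ with hV
  have hV0 : 0 ≤ V := measureReal_nonneg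
  -- Chosen so that the uniform error contributes `2 δ² V ≤ ε / 2`; the continuous approximation
  -- contributes the other half.
  set δ : ℝ := Real.sqrt (ε / (4 * (V + 1))) with hδ
  have hδ2 : δ ^ 2 = ε / (4 * (V + 1)) := Real.sq_sqrt (by positivity)
  have hδ0 : 0 < δ := Real.sqrt_pos.2 (by positivity)
  obtain ⟨r, hr⟩ := exists_polynomial_near_of_continuousOn (-1) 1 g g.continuous.continuousOn δ hδ0
  refine ⟨r, ?_⟩
  have hg' : ∫ x, (h x - g x) ^ 2 ∂jacobiMeasure a ≤ ε / 4 := by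
    refine le_trans (le_of_eq (integral_congr_ae (ae_of_all _ fun x => ?_))) hg
    simp [Real.norm_eq_abs, sq_abs]
  have hi1 : Integrable (fun x => (h x - g x) ^ 2) (jacobiMeasure a) := (hh.sub hgm).integrable_sq
  calc ∫ x, (h x - r.eval x) ^ 2 ∂jacobiMeasure a
      ≤ ∫ x, (2 * (h x - g x) ^ 2 + 2 * δ ^ 2) ∂jacobiMeasure a := by
        refine integral_mono_ae (hh.sub (memLp_eval a r)).integrable_sq
          ((hi1.const_mul 2).add (integrable_const _)) ?_
        filter_upwards [ae_mem_Lam a] with x hx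
        have h3 := (abs_lt.1 (hr x (Set.Ioo_subset_Icc_self hx)))
        have h4 : (r.eval x - g x) ^ 2 ≤ δ ^ 2 := by nlinarith
        nlinarith [sq_nonneg ((h x - g x) + (r.eval x - g x))]
    _ = 2 * ∫ x, (h x - g x) ^ 2 ∂jacobiMeasure a + V * (2 * δ ^ 2) := by
        rw [integral_add (hi1.const_mul 2) (integrable_const _), integral_const_mul,
          integral_const, smul_eq_mul]
    _ ≤ 2 * (ε / 4) + ε / 2 := by
        have : V * (2 * δ ^ 2) ≤ ε / 2 := by
          rw [hδ2, show V * (2 * (ε / (4 * (V + 1)))) = ε / 2 * (V / (V + 1)) by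
            field_simp; ring]
          have : V / (V + 1) ≤ 1 := by rw [div_le_one (by positivity)]; linarith
          nlinarith
        linarith
    _ = ε := by ring

/-! ### Cutoffs and integration by parts -/

/-- A smooth cutoff function, equal to one where `n (1 - x ^ 2) ≥ 2` and to zero where
`n (1 - x ^ 2) ≤ 1`. -/
noncomputable def cutoff (n : ℕ) (x : ℝ) : ℝ := Real.smoothTransition (n * (1 - x ^ 2) - 1)

theorem contDiff_cutoff (n : ℕ) : ContDiff ℝ ∞ (cutoff n) :=
  Real.smoothTransition.contDiff.comp (by fun_prop)

theorem cutoff_nonneg (n : ℕ) (x : ℝ) : 0 ≤ cutoff n x := Real.smoothTransition.nonneg _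

theorem cutoff_le_one (n : ℕ) (x : ℝ) : cutoff n x ≤ 1 := Real.smoothTransition.le_one _

theorem tsupport_cutoff_subset (n : ℕ) :
    tsupport (cutoff n) ⊆ {x : ℝ | 1 ≤ n * (1 - x ^ 2)} := by
  refine closure_minimal (fun x hx => ?_) (isClosed_le (by fun_prop) (by fun_prop))
  by_contra h
  refine hx (Real.smoothTransition.zero_of_nonpos ?_)
  simp only [Set.mem_ofPred_eq, not_le] at h
  linarith

theorem tsupport_cutoff_subset_Lam (n : ℕ) : tsupport (cutoff n) ⊆ Lam := by
  intro x hx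
  have h : (1 : ℝ) ≤ n * (1 - x ^ 2) := tsupport_cutoff_subset n hx
  have hn : (0 : ℝ) ≤ n := n.cast_nonneg
  have hx2 : 0 < 1 - x ^ 2 := by
    by_contra hc
    nlinarith
  exact ⟨by nlinarith, by nlinarith⟩

theorem hasCompactSupport_cutoff (n : ℕ) : HasCompactSupport (cutoff n) :=
  isCompact_Icc.of_isClosed_subset (isClosed_tsupport _)
    ((tsupport_cutoff_subset_Lam n).trans Set.Ioo_subset_Icc_self)

theorem hasDerivAt_cutoff (n : ℕ) (x : ℝ) :
    HasDerivAt (cutoff n)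
      (deriv Real.smoothTransition (n * (1 - x ^ 2) - 1) * (n * (-(2 * x)))) x := by
  have h1 : HasDerivAt Real.smoothTransition
      (deriv Real.smoothTransition (n * (1 - x ^ 2) - 1)) (n * (1 - x ^ 2) - 1) :=
    ((Real.smoothTransition.contDiff (n := 1)).differentiable (by norm_num) _).hasDerivAt
  have h2 : HasDerivAt (fun x : ℝ => (n : ℝ) * (1 - x ^ 2) - 1) (n * (-(2 * x))) x := by
    have := (((hasDerivAt_pow 2 x).const_sub 1).const_mul (n : ℝ)).sub_const 1
    simpa using this
  exact h1.comp x h2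

theorem deriv_smoothTransition_of_one_lt {y : ℝ} (hy : 1 < y) :
    deriv Real.smoothTransition y = 0 := by
  have : Real.smoothTransition =ᶠ[𝓝 y] fun _ => 1 := by
    filter_upwards [lt_mem_nhds hy] with z hz
    exact Real.smoothTransition.one_of_one_le hz.le
  rw [this.deriv_eq, deriv_const]

/-- The derivative grows like `n`, but vanishes unless `n (1 - x ^ 2) ≤ 2`, so the factor `1 - x ^
2` absorbs the growth uniformly in `n`. -/
theorem exists_bound_deriv_cutoff :
    ∃ C : ℝ, 0 ≤ C ∧ ∀ n : ℕ, ∀ x ∈ Lam, |deriv (cutoff n) x * (1 - x ^ 2)| ≤ C := by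
  have hc : Continuous (deriv Real.smoothTransition) :=
    (Real.smoothTransition.contDiff (n := 1)).continuous_deriv (by norm_num)
  obtain ⟨C, hC⟩ := (isCompact_Icc (a := (-1 : ℝ)) (b := 1)).exists_bound_of_continuousOn
    hc.continuousOn
  have hC0 : 0 ≤ C := (norm_nonneg _).trans (hC 0 (by norm_num))
  refine ⟨C * 4, by positivity, fun n x hx => ?_⟩
  rw [(hasDerivAt_cutoff n x).deriv]
  have hx2 := one_sub_sq_pos hx
  have hn : (0 : ℝ) ≤ n := n.cast_nonneg
  by_cases hy : 1 < n * (1 - x ^ 2) - 1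
  · rw [deriv_smoothTransition_of_one_lt hy]
    simpa using hC0
  · push Not at hy
    have h1 := hC (n * (1 - x ^ 2) - 1) ⟨by nlinarith, hy⟩
    rw [Real.norm_eq_abs] at h1
    have hx1 : |x| ≤ 1 := abs_le.2 ⟨hx.1.le, hx.2.le⟩
    rw [mul_assoc, abs_mul]
    refine mul_le_mul h1 ?_ (abs_nonneg _) hC0
    rw [show (n : ℝ) * (-(2 * x)) * (1 - x ^ 2) = -2 * x * (n * (1 - x ^ 2)) by ring, abs_mul,
      abs_mul, abs_of_nonneg (show (0 : ℝ) ≤ n * (1 - x ^ 2) by positivity)]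
    norm_num
    have : 0 ≤ |x| := abs_nonneg x
    nlinarith

theorem tendsto_mul_one_sub_sq {x : ℝ} (hx : x ∈ Lam) :
    ∀ᶠ n : ℕ in atTop, 2 < n * (1 - x ^ 2) :=
  (tendsto_natCast_atTop_atTop.atTop_mul_const (one_sub_sq_pos hx)).eventually_gt_atTop 2

theorem eventually_cutoff_eq_one {x : ℝ} (hx : x ∈ Lam) : ∀ᶠ n : ℕ in atTop, cutoff n x = 1 := by
  filter_upwards [tendsto_mul_one_sub_sq hx] with n hn
  exact Real.smoothTransition.one_of_one_le (by linarith)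

theorem eventually_deriv_cutoff_eq_zero {x : ℝ} (hx : x ∈ Lam) :
    ∀ᶠ n : ℕ in atTop, deriv (cutoff n) x = 0 := by
  filter_upwards [tendsto_mul_one_sub_sq hx] with n hn
  rw [(hasDerivAt_cutoff n x).deriv, deriv_smoothTransition_of_one_lt (by linarith), zero_mul]

/-- The polynomial `(1 - x ^ 2) ^ (-a) ((1 - x ^ 2) ^ (a + 1) r)'`. -/
noncomputable def weightedDeriv (a : ℕ) (r : ℝ[X]) : ℝ[X] :=
  (1 - X ^ 2) * derivative r - C (2 * (a + 1 : ℝ)) * X * r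

theorem hasDerivAt_weight_mul_eval (a : ℕ) (r : ℝ[X]) (x : ℝ) :
    HasDerivAt (fun x : ℝ => (1 - x ^ 2) ^ (a + 1) * r.eval x)
      ((1 - x ^ 2) ^ a * (weightedDeriv a r).eval x) x := by
  have h1 : HasDerivAt (fun x : ℝ => 1 - x ^ 2) (-(2 * x)) x := by
    simpa using (hasDerivAt_pow 2 x).const_sub 1
  refine ((h1.fun_pow (a + 1)).mul (r.hasDerivAt x)).congr_deriv ?_
  simp only [weightedDeriv, eval_sub, eval_mul, eval_one, eval_pow, eval_X, eval_C]
  push_cast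
  ring

/-- Integration by parts in the weighted spaces, without boundary terms. -/
theorem integral_mul_weightedDeriv {a : ℕ} {h h' : ℝ → ℝ} (hw : HasWeakDeriv 1 h h')
    (hh : MemLp h 2 (jacobiMeasure a)) (hh' : MemLp h' 2 (jacobiMeasure (a + 1))) (r : ℝ[X]) :
    ∫ x, h x * (weightedDeriv a r).eval x ∂jacobiMeasure a =
      -∫ x, h' x * r.eval x ∂jacobiMeasure (a + 1) := by
  obtain ⟨K, hK0, hK⟩ := exists_bound_deriv_cutoff
  obtain ⟨R, hR0, hR⟩ := exists_bound_eval r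
  obtain ⟨A, hA0, hA⟩ := exists_bound_eval (weightedDeriv a r)
  have hh1 : Integrable h (jacobiMeasure a) := hh.integrable (by norm_num)
  have hcd (n : ℕ) : Continuous (deriv (cutoff n)) :=
    (contDiff_cutoff n).continuous_deriv (by simp)
  have key (n : ℕ) :
      ∫ x, h x * (deriv (cutoff n) x * (1 - x ^ 2) * r.eval x
          + cutoff n x * (weightedDeriv a r).eval x) ∂jacobiMeasure a =
        -∫ x, h' x * r.eval x * cutoff n x ∂jacobiMeasure (a + 1) := by
    -- The test function carries one power of `1 - x ^ 2` more than the measure; that spare power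
    -- tames the derivative of the cutoff, and dominated convergence then removes the cutoff.
    have h1 := hw.2.2 (fun x => cutoff n x * ((1 - x ^ 2) ^ (a + 1) * r.eval x))
      ((contDiff_cutoff n).mul (ContDiff.mul (by fun_prop) (by simpa using r.contDiff_aeval (𝕜 := ℝ) ∞))) ((hasCompactSupport_cutoff n).mul_right)
      ((tsupport_mul_subset_left).trans (tsupport_cutoff_subset_Lam n))
    rw [integral_jacobiMeasure, integral_jacobiMeasure]
    convert h1 using 1
    · refine integral_congr_ae (ae_of_all _ fun x => ?_)
      simp only [iteratedDeriv_one]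
      rw [((hasDerivAt_cutoff n x).differentiableAt.hasDerivAt.fun_mul
        (hasDerivAt_weight_mul_eval a r x)).deriv]
      ring
    · rw [pow_one, neg_one_mul]
      congr 1
      refine integral_congr_ae (ae_of_all _ fun x => ?_)
      simp only
      ring
  have lim1 : Tendsto (fun n : ℕ => ∫ x, h x * (deriv (cutoff n) x * (1 - x ^ 2) * r.eval x
      + cutoff n x * (weightedDeriv a r).eval x) ∂jacobiMeasure a) atTop
      (𝓝 (∫ x, h x * (weightedDeriv a r).eval x ∂jacobiMeasure a)) := by
    refine tendsto_integral_of_dominated_convergence (fun x => |h x| * (K * R + A))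
      (fun n => ?_) (hh1.abs.mul_const _) (fun n => ?_) ?_
    · refine hh.1.mul (Continuous.aestronglyMeasurable ?_)
      have := hcd n
      have := (contDiff_cutoff n).continuous
      fun_prop
    · filter_upwards [ae_mem_Lam a] with x hx
      rw [norm_mul, Real.norm_eq_abs, Real.norm_eq_abs]
      refine mul_le_mul_of_nonneg_left ((abs_add_le _ _).trans (add_le_add ?_ ?_)) (abs_nonneg _)
      · rw [abs_mul]
        exact mul_le_mul (hK n x hx) (hR x hx) (abs_nonneg _) hK0
      · rw [abs_mul, abs_of_nonneg (cutoff_nonneg n x)]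
        nlinarith [hA x hx, cutoff_nonneg n x, cutoff_le_one n x,
          abs_nonneg ((weightedDeriv a r).eval x)]
    · filter_upwards [ae_mem_Lam a] with x hx
      refine tendsto_const_nhds.congr' ?_
      filter_upwards [eventually_cutoff_eq_one hx, eventually_deriv_cutoff_eq_zero hx]
        with n h1 h2
      rw [h1, h2]
      ring
  have lim2 : Tendsto (fun n : ℕ => ∫ x, h' x * r.eval x * cutoff n x ∂jacobiMeasure (a + 1))
      atTop (𝓝 (∫ x, h' x * r.eval x ∂jacobiMeasure (a + 1))) := by
    refine tendsto_integral_of_dominated_convergence (fun x => |h' x * r.eval x|)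
      (fun n => ?_) (integrable_mul_eval hh' r).abs (fun n => ?_) ?_
    · exact (integrable_mul_eval hh' r).1.mul (contDiff_cutoff n).continuous.aestronglyMeasurable
    · refine ae_of_all _ fun x => ?_
      rw [norm_mul, Real.norm_eq_abs, Real.norm_eq_abs, abs_of_nonneg (cutoff_nonneg n x)]
      exact mul_le_of_le_one_right (abs_nonneg _) (cutoff_le_one n x)
    · filter_upwards [ae_mem_Lam (a + 1)] with x hx
      refine tendsto_const_nhds.congr' ?_
      filter_upwards [eventually_cutoff_eq_one hx] with n h1
      rw [h1, mul_one]
  simp only [key] at lim1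
  exact tendsto_nhds_unique lim1 lim2.neg

/-! ### The Jacobi operator on polynomials -/

/-- The inner product of the weighted space, restricted to polynomials. -/
noncomputable def polyForm (a : ℕ) : ℝ[X] →ₗ[ℝ] ℝ[X] →ₗ[ℝ] ℝ :=
  LinearMap.mk₂ ℝ (fun p q => ∫ x, p.eval x * q.eval x ∂jacobiMeasure a)
    (fun p p' q => by
      simp only [eval_add, add_mul]
      exact integral_add (integrable_eval_mul_eval a p q) (integrable_eval_mul_eval a p' q))
    (fun c p q => by
      simp only [eval_smul, smul_eq_mul, mul_assoc]
      exact integral_const_mul _ _)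
    (fun p q q' => by
      simp only [eval_add, mul_add]
      exact integral_add (integrable_eval_mul_eval a p q) (integrable_eval_mul_eval a p q'))
    (fun c p q => by
      simp only [eval_smul, smul_eq_mul, mul_left_comm _ c]
      exact integral_const_mul _ _)

theorem polyForm_apply (a : ℕ) (p q : ℝ[X]) :
    polyForm a p q = ∫ x, p.eval x * q.eval x ∂jacobiMeasure a := rfl

theorem polyForm_comm (a : ℕ) (p q : ℝ[X]) : polyForm a p q = polyForm a q p := by
  simp only [polyForm_apply, mul_comm]

theorem polyForm_self_nonneg (a : ℕ) (p : ℝ[X]) : 0 ≤ polyForm a p p :=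
  integral_nonneg fun _ => mul_self_nonneg _

/-- Riesz representation in finite dimension: definiteness makes the map to the dual injective,
hence surjective. It supplies all orthogonal projections used here. -/
theorem exists_polyForm_eq (a M : ℕ) (ℓ : ℝ[X] →ₗ[ℝ] ℝ) :
    ∃ p : ℝ[X], p.natDegree ≤ M ∧ ∀ r : ℝ[X], r.natDegree ≤ M → polyForm a p r = ℓ r := by
  have hmem (p : ℝ[X]) : p ∈ degreeLT ℝ (M + 1) ↔ p.natDegree ≤ M := by
    rw [degreeLT_succ_eq_degreeLE, mem_degreeLE, natDegree_le_iff_degree_le]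
  have : FiniteDimensional ℝ (degreeLT ℝ (M + 1)) :=
    Module.Finite.equiv (degreeLTEquiv ℝ (M + 1)).symm
  let B : degreeLT ℝ (M + 1) →ₗ[ℝ] Module.Dual ℝ (degreeLT ℝ (M + 1)) :=
    (polyForm a).domRestrict₁₂ _ _
  have hinj : Function.Injective B := by
    rw [← LinearMap.ker_eq_bot, LinearMap.ker_eq_bot']
    intro p hp
    have : polyForm a p p = 0 := LinearMap.congr_fun hp p
    exact Subtype.ext (eq_zero_of_integral_sq_eq_zero this)
  obtain ⟨p, hp⟩ := (LinearMap.injective_iff_surjective_of_finrank_eq_finrank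
    Subspace.dual_finrank_eq.symm).1 hinj (ℓ.domRestrict _)
  exact ⟨p, (hmem _).1 p.2, fun r hr => LinearMap.congr_fun hp ⟨r, (hmem r).2 hr⟩⟩

/-- The Jacobi differential operator `q ↦ -(1 - x ^ 2) ^ (-a) ((1 - x ^ 2) ^ (a + 1) q')'`. -/
noncomputable def jacobiOp (a : ℕ) (q : ℝ[X]) : ℝ[X] := -weightedDeriv a (derivative q)

/-- The operator is triangular on monomials, so the eigenvalues `j (j + 2a + 1)` can be read off the
diagonal. -/
theorem coeff_jacobiOp (a : ℕ) (q : ℝ[X]) (j : ℕ) :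
    (jacobiOp a q).coeff j =
      j * (j + 2 * a + 1) * q.coeff j - (j + 1) * (j + 2) * q.coeff (j + 2) := by
  obtain ⟨c, hc⟩ : ∃ c : ℝ, c = 2 * (a + 1) := ⟨_, rfl⟩
  rw [jacobiOp, weightedDeriv, sub_mul, one_mul, mul_assoc, ← hc]
  rcases j with _ | _ | j
  · simp [coeff_derivative]
    ring
  · simp [coeff_derivative, coeff_X_pow_mul']
    rw [hc]
    ring
  · simp [coeff_derivative, coeff_X_pow_mul']
    rw [hc]
    ring

theorem natDegree_jacobiOp_le (a : ℕ) {q : ℝ[X]} {n : ℕ} (hq : q.natDegree ≤ n) :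
    (jacobiOp a q).natDegree ≤ n := by
  rw [natDegree_le_iff_coeff_eq_zero] at hq ⊢
  intro j hj
  rw [coeff_jacobiOp, hq j hj, hq (j + 2) (by omega)]
  ring

theorem jacobiOp_add (a : ℕ) (p q : ℝ[X]) :
    jacobiOp a (p + q) = jacobiOp a p + jacobiOp a q := by
  simp only [jacobiOp, weightedDeriv, derivative_add]
  ring

theorem jacobiOp_smul (a : ℕ) (c : ℝ) (q : ℝ[X]) : jacobiOp a (c • q) = c • jacobiOp a q := by
  simp only [jacobiOp, weightedDeriv, derivative_smul]
  simp only [smul_eq_C_mul]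
  ring

theorem integral_mul_jacobiOp {a : ℕ} {h h' : ℝ → ℝ} (hw : HasWeakDeriv 1 h h')
    (hh : MemLp h 2 (jacobiMeasure a)) (hh' : MemLp h' 2 (jacobiMeasure (a + 1))) (q : ℝ[X]) :
    ∫ x, h x * (jacobiOp a q).eval x ∂jacobiMeasure a =
      ∫ x, h' x * (derivative q).eval x ∂jacobiMeasure (a + 1) := by
  have := integral_mul_weightedDeriv hw hh hh' (derivative q)
  simp only [jacobiOp, eval_neg, mul_neg]
  rw [integral_neg, this, neg_neg]

theorem locallyIntegrableOn_of_continuous {v : ℝ → ℝ} (hv : Continuous v) (s : Set ℝ) :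
    LocallyIntegrableOn v s :=
  hv.locallyIntegrable.locallyIntegrableOn s

theorem setIntegral_Lam_mul_of_tsupport_subset (v : ℝ → ℝ) {φ : ℝ → ℝ} (h : tsupport φ ⊆ Lam) :
    ∫ x in Lam, v x * φ x = ∫ x, v x * φ x := by
  refine setIntegral_eq_integral_of_forall_compl_eq_zero fun x hx => ?_
  rw [image_eq_zero_of_notMem_tsupport fun hx' => hx (h hx'), mul_zero]

theorem hasWeakDeriv_derivative (p : ℝ[X]) :
    HasWeakDeriv 1 (fun x => p.eval x) (fun x => (derivative p).eval x) := by
  refine ⟨locallyIntegrableOn_of_continuous p.continuous _,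
    locallyIntegrableOn_of_continuous (derivative p).continuous _, fun φ hφ hc hs => ?_⟩
  have hφc := hφ.continuous
  have hφ' : Continuous (deriv φ) := hφ.continuous_deriv (by simp)
  rw [iteratedDeriv_one, pow_one, neg_one_mul,
    setIntegral_Lam_mul_of_tsupport_subset _ (tsupport_deriv_subset.trans hs),
    setIntegral_Lam_mul_of_tsupport_subset _ hs]
  refine integral_mul_deriv_eq_deriv_mul_of_integrable (fun x _ => p.hasDerivAt x)
    (fun x _ => (hφ.differentiable (by simp) x).hasDerivAt) ?_ ?_ ?_
  · exact (p.continuous.mul hφ').integrable_of_hasCompactSupport hc.deriv.mul_left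
  · exact ((derivative p).continuous.mul hφc).integrable_of_hasCompactSupport hc.mul_left
  · exact (p.continuous.mul hφc).integrable_of_hasCompactSupport hc.mul_left

theorem polyForm_jacobiOp (a : ℕ) (p q : ℝ[X]) :
    polyForm a p (jacobiOp a q) = polyForm (a + 1) (derivative p) (derivative q) :=
  integral_mul_jacobiOp (hasWeakDeriv_derivative p) (memLp_eval a p)
    (memLp_eval (a + 1) (derivative p)) q

theorem polyForm_jacobiOp_comm (a : ℕ) (p q : ℝ[X]) :
    polyForm a (jacobiOp a p) q = polyForm a p (jacobiOp a q) := by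
  rw [polyForm_comm, polyForm_jacobiOp, polyForm_jacobiOp, polyForm_comm]

/-- The monic orthogonal polynomials are eigenvectors of the Jacobi operator. -/
theorem exists_eigenpolynomial (a M : ℕ) :
    ∃ Q : ℝ[X], Q.natDegree ≤ M + 1 ∧ Q.coeff (M + 1) = 1 ∧
      (∀ r : ℝ[X], r.natDegree ≤ M → polyForm a Q r = 0) ∧
      jacobiOp a Q = ((M + 1 : ℝ) * (M + 2 * a + 2)) • Q := by
  obtain ⟨p, hp, hpr⟩ := exists_polyForm_eq a M (polyForm a (X ^ (M + 1)))
  have hpc : p.coeff (M + 1) = 0 := coeff_eq_zero_of_natDegree_lt (by omega)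
  have hdeg : (X ^ (M + 1) - p).natDegree ≤ M + 1 :=
    (natDegree_sub_le _ _).trans (max_le (natDegree_X_pow_le _) (by omega))
  have horth (r : ℝ[X]) (hr : r.natDegree ≤ M) : polyForm a (X ^ (M + 1) - p) r = 0 := by
    rw [map_sub, LinearMap.sub_apply, hpr r hr, sub_self]
  have hcoeff : (X ^ (M + 1) - p).coeff (M + 1) = 1 := by simp [hpc]
  generalize X ^ (M + 1) - p = Q at hdeg horth hcoeff
  refine ⟨Q, hdeg, hcoeff, horth, ?_⟩
  -- The leading terms cancel, so `d` has degree at most `M`; by symmetry of the operator it is also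
  -- orthogonal to that space, hence zero.
  set d := jacobiOp a Q - ((M + 1 : ℝ) * (M + 2 * a + 2)) • Q with hd
  have hdd : d.natDegree ≤ M := by
    rw [natDegree_le_iff_coeff_eq_zero]
    intro j hj
    rw [natDegree_le_iff_coeff_eq_zero] at hdeg
    rw [hd, coeff_sub, coeff_smul, coeff_jacobiOp, smul_eq_mul, hdeg (j + 2) (by omega)]
    rcases eq_or_lt_of_le (Nat.succ_le_of_lt hj) with h | h
    · rw [← h]
      push_cast
      ring
    · rw [hdeg j h]
      ring
  have h0 : polyForm a d d = 0 := by
    have : polyForm a d d =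
        polyForm a (jacobiOp a Q - ((M + 1 : ℝ) * (M + 2 * a + 2)) • Q) d := rfl
    rw [this, map_sub (polyForm a), LinearMap.sub_apply, map_smul, LinearMap.smul_apply, horth d hdd,
      polyForm_jacobiOp_comm, horth _ (natDegree_jacobiOp_le a hdd)]
    simp
  exact sub_eq_zero.1 (eq_zero_of_integral_sq_eq_zero h0)

/-- On the orthogonal complement of the polynomials of degree at most `n` the Jacobi operator
has an inverse, bounded by the reciprocal of the `n + 1`-st eigenvalue. -/
theorem exists_jacobiOp_eq (a n d : ℕ) :
    ∀ p : ℝ[X], p.natDegree ≤ n + d →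
      (∀ r : ℝ[X], r.natDegree ≤ n → polyForm a p r = 0) →
      ∃ q : ℝ[X], q.natDegree ≤ n + d ∧ jacobiOp a q = p ∧
        (n + 1 : ℝ) * (n + 2 * a + 2) * polyForm a p q ≤ polyForm a p p := by
  induction d with
  | zero =>
    intro p hp horth
    have : p = 0 := eq_zero_of_integral_sq_eq_zero (horth p hp)
    subst this
    exact ⟨0, by simp, by simp [jacobiOp, weightedDeriv], by simp⟩
  | succ d ih =>
    intro p hp horth
    obtain ⟨Q, hQd, hQc, hQo, hQe⟩ := exists_eigenpolynomial a (n + d)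
    set c := p.coeff (n + d + 1) with hc
    set l : ℝ := ((n + d : ℕ) + 1 : ℝ) * ((n + d : ℕ) + 2 * a + 2) with hl
    have hl0 : 0 < l := by positivity
    -- Splitting off the top eigenvector lowers the degree; both quadratic forms split orthogonally,
    -- and the eigenvalue `l` is at least the required constant.
    obtain ⟨p', hp'⟩ : ∃ p', p = p' + c • Q := ⟨p - c • Q, by ring⟩
    have hp'd : p'.natDegree ≤ n + d := by
      rw [natDegree_le_iff_coeff_eq_zero]
      intro j hj
      have hj' : p'.coeff j = p.coeff j - c * Q.coeff j := by rw [hp']; simp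
      rcases eq_or_lt_of_le (Nat.succ_le_of_lt hj) with h | h
      · rw [hj', ← h, Nat.succ_eq_add_one, hQc, hc]
        ring
      · rw [hj', coeff_eq_zero_of_natDegree_lt (lt_of_le_of_lt hQd h),
          coeff_eq_zero_of_natDegree_lt (lt_of_le_of_lt hp h)]
        ring
    obtain ⟨q', hq'd, hq', hq'i⟩ := ih p' hp'd fun r hr => by
      have := horth r hr
      rw [hp', map_add, LinearMap.add_apply, map_smul, LinearMap.smul_apply,
        hQo r (by omega)] at this
      simpa using this
    refine ⟨q' + (c / l) • Q, ?_, ?_, ?_⟩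
    · refine (natDegree_add_le _ _).trans (max_le (by omega) ((natDegree_smul_le _ _).trans hQd))
    · rw [jacobiOp_add, jacobiOp_smul, hq', hQe, hp', smul_smul, div_mul_cancel₀ _ hl0.ne']
    · have e1 : polyForm a p (q' + (c / l) • Q) =
          polyForm a p' q' + c ^ 2 / l * polyForm a Q Q := by
        rw [hp']
        simp only [map_add, LinearMap.add_apply, map_smul, LinearMap.smul_apply, smul_eq_mul,
          hQo q' hq'd, polyForm_comm a p' Q, hQo p' hp'd]
        ring
      have e2 : polyForm a p p = polyForm a p' p' + c ^ 2 * polyForm a Q Q := by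
        rw [hp']
        simp only [map_add, LinearMap.add_apply, map_smul, LinearMap.smul_apply, smul_eq_mul,
          polyForm_comm a p' Q, hQo p' hp'd]
        ring
      rw [e1, e2, mul_add]
      refine add_le_add hq'i ?_
      have hle : (n + 1 : ℝ) * (n + 2 * a + 2) ≤ l := by
        rw [hl]
        push_cast
        gcongr <;> simp
      have := polyForm_self_nonneg a Q
      calc (n + 1 : ℝ) * (n + 2 * a + 2) * (c ^ 2 / l * polyForm a Q Q)
          ≤ l * (c ^ 2 / l * polyForm a Q Q) := by gcongr
        _ = c ^ 2 * polyForm a Q Q := by field_simp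

/-! ### The weighted Poincaré inequality -/

theorem integral_sub_eval_sq {a : ℕ} {h : ℝ → ℝ} (hh : MemLp h 2 (jacobiMeasure a)) {p : ℝ[X]}
    (hp : ∫ x, (h x - p.eval x) * p.eval x ∂jacobiMeasure a = 0) :
    ∫ x, h x ^ 2 ∂jacobiMeasure a =
      ∫ x, (h x - p.eval x) ^ 2 ∂jacobiMeasure a + polyForm a p p := by
  have hs : MemLp (fun x => h x - p.eval x) 2 (jacobiMeasure a) := hh.sub (memLp_eval a p)
  have i1 := hs.integrable_sq
  have i2 := (integrable_mul_eval hs p).const_mul 2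
  have i3 := integrable_eval_mul_eval a p p
  calc ∫ x, h x ^ 2 ∂jacobiMeasure a
      = ∫ x, ((h x - p.eval x) ^ 2 + 2 * ((h x - p.eval x) * p.eval x)
          + p.eval x * p.eval x) ∂jacobiMeasure a := by
        congr 1
        ext x
        ring
    _ = _ := by
        rw [integral_add (by exact i1.add i2) i3, integral_add i1 i2, integral_const_mul, hp,
          polyForm_apply]
        ring

/-- The weighted Poincaré inequality for functions orthogonal to the polynomials of degree at
most `n`. -/
theorem integral_sq_le_of_orthogonal {a n : ℕ} {h h' : ℝ → ℝ} (hw : HasWeakDeriv 1 h h')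
    (hh : MemLp h 2 (jacobiMeasure a)) (hh' : MemLp h' 2 (jacobiMeasure (a + 1)))
    (horth : ∀ r : ℝ[X], r.natDegree ≤ n → ∫ x, h x * r.eval x ∂jacobiMeasure a = 0) :
    (n + 1 : ℝ) * (n + 2 * a + 2) * ∫ x, h x ^ 2 ∂jacobiMeasure a ≤
      ∫ x, h' x ^ 2 ∂jacobiMeasure (a + 1) := by
  set l : ℝ := (n + 1 : ℝ) * (n + 2 * a + 2) with hl
  have hl0 : 0 < l := by positivity
  let ℓ : ℝ[X] →ₗ[ℝ] ℝ :=
    { toFun := fun r => ∫ x, h x * r.eval x ∂jacobiMeasure a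
      map_add' := fun r r' => by
        simp only [eval_add, mul_add]
        exact integral_add (integrable_mul_eval hh r) (integrable_mul_eval hh r')
      map_smul' := fun c r => by
        simp only [eval_smul, smul_eq_mul, mul_left_comm _ c]
        exact integral_const_mul _ _ }
  refine le_of_forall_pos_le_add fun ε hε => ?_
  obtain ⟨r, hr⟩ := exists_polynomial_integral_sq_sub_le hh (div_pos hε hl0)
  -- `p` is the projection of `h` to a degree large enough to contain `r`, so it is at least as
  -- close to `h` as `r` is, and it inherits the orthogonality of `h`.
  obtain ⟨p, hpd, hp⟩ := exists_polyForm_eq a (n + r.natDegree) ℓ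
  have hp' (t : ℝ[X]) (ht : t.natDegree ≤ n + r.natDegree) :
      ∫ x, (h x - p.eval x) * t.eval x ∂jacobiMeasure a = 0 := by
    simp only [sub_mul]
    rw [integral_sub (integrable_mul_eval hh t) (integrable_eval_mul_eval a p t), sub_eq_zero]
    exact (hp t ht).symm
  obtain ⟨q, hqd, hq, hqi⟩ := exists_jacobiOp_eq a n r.natDegree p hpd fun t ht =>
    (hp t (by omega)).trans (horth t ht)
  have hpp : polyForm a p p = ∫ x, h' x * (derivative q).eval x ∂jacobiMeasure (a + 1) := by
    rw [hp p hpd, ← integral_mul_jacobiOp hw hh hh' q, hq]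
    rfl
  have hpq : polyForm a p q = polyForm (a + 1) (derivative q) (derivative q) := by
    rw [← polyForm_jacobiOp, hq, polyForm_comm]
  -- Integrating `2 l h' q' ≤ h' ^ 2 + l ^ 2 q' ^ 2`. As `l * polyForm a p q ≤ polyForm a p p`, the
  -- last term is absorbed by half of the left side.
  have hyoung : 2 * l * polyForm a p p ≤
      ∫ x, h' x ^ 2 ∂jacobiMeasure (a + 1) + l ^ 2 * polyForm a p q := by
    rw [hpp, hpq, polyForm_apply, ← integral_const_mul, ← integral_const_mul,
      ← integral_add hh'.integrable_sq ((integrable_eval_mul_eval _ _ _).const_mul _)]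
    refine integral_mono ((integrable_mul_eval hh' _).const_mul _)
      (hh'.integrable_sq.add ((integrable_eval_mul_eval _ _ _).const_mul _)) fun x => ?_
    simp only
    nlinarith [sq_nonneg (h' x - l * (derivative q).eval x)]
  have hlp : l * polyForm a p p ≤ ∫ x, h' x ^ 2 ∂jacobiMeasure (a + 1) := by
    nlinarith
  have hdist : ∫ x, (h x - p.eval x) ^ 2 ∂jacobiMeasure a ≤ ε / l := by
    refine le_trans ?_ hr
    have hs : MemLp (fun x => h x - r.eval x) 2 (jacobiMeasure a) := hh.sub (memLp_eval a r)
    have e := integral_sub_eval_sq hs (p := p - r) (by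
      have := hp' (p - r) ((natDegree_sub_le _ _).trans (max_le hpd (by omega)))
      refine Eq.trans (integral_congr_ae (ae_of_all _ fun x => ?_)) this
      simp only [eval_sub]
      ring)
    rw [e]
    refine le_add_of_le_of_nonneg (le_of_eq ?_) (polyForm_self_nonneg _ _)
    refine integral_congr_ae (ae_of_all _ fun x => ?_)
    simp only [eval_sub]
    ring
  rw [integral_sub_eval_sq hh (hp' p hpd), mul_add]
  have : l * ∫ x, (h x - p.eval x) ^ 2 ∂jacobiMeasure a ≤ ε := by
    calc _ ≤ l * (ε / l) := by gcongr
      _ = ε := by field_simp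
  linarith

/-! ### Calculus of weak derivatives -/

theorem tsupport_iteratedDeriv_subset (n : ℕ) (φ : ℝ → ℝ) :
    tsupport (iteratedDeriv n φ) ⊆ tsupport φ := by
  induction n with
  | zero => rw [iteratedDeriv_zero]
  | succ n ih =>
    rw [iteratedDeriv_succ]
    exact tsupport_deriv_subset.trans ih

theorem integrableOn_Lam_mul {v φ : ℝ → ℝ} (hv : LocallyIntegrableOn v Lam) (hφ : Continuous φ)
    (hc : HasCompactSupport φ) (hs : tsupport φ ⊆ Lam) :
    IntegrableOn (fun x => v x * φ x) Lam := by
  have h1 : IntegrableOn (fun x => v x * φ x) (tsupport φ) :=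
    (hv.integrableOn_compact_subset hs hc).mul_continuousOn hφ.continuousOn hc
  refine IntegrableOn.of_forall_sdiff_eq_zero h1 measurableSet_Lam fun x hx => ?_
  rw [image_eq_zero_of_notMem_tsupport hx.2, mul_zero]

theorem HasWeakDeriv.sub {n : ℕ} {v w v' w' : ℝ → ℝ} (h : HasWeakDeriv n v w)
    (h' : HasWeakDeriv n v' w') :
    HasWeakDeriv n (fun x => v x - v' x) (fun x => w x - w' x) := by
  refine ⟨h.1.sub h'.1, h.2.1.sub h'.2.1, fun φ hφ hc hs => ?_⟩
  have hts := tsupport_iteratedDeriv_subset n φ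
  have hcn : HasCompactSupport (iteratedDeriv n φ) := hc.of_isClosed_subset (isClosed_tsupport _) hts
  have hφn : Continuous (iteratedDeriv n φ) := hφ.continuous_iteratedDeriv n (by exact_mod_cast le_top)
  simp only [sub_mul]
  rw [integral_sub (integrableOn_Lam_mul h.1 hφn hcn (hts.trans hs))
      (integrableOn_Lam_mul h'.1 hφn hcn (hts.trans hs)),
    integral_sub (integrableOn_Lam_mul h.2.1 hφ.continuous hc hs)
      (integrableOn_Lam_mul h'.2.1 hφ.continuous hc hs),
    h.2.2 φ hφ hc hs, h'.2.2 φ hφ hc hs]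
  ring

theorem locallyIntegrableOn_Lam_congr {v v' : ℝ → ℝ} (hv : LocallyIntegrableOn v Lam)
    (h : ∀ᵐ x ∂volume.restrict Lam, v x = v' x) : LocallyIntegrableOn v' Lam := by
  rw [locallyIntegrableOn_iff isOpen_Lam.isLocallyClosed] at hv ⊢
  intro K hK hKc
  exact (hv K hK hKc).congr_fun_ae (ae_restrict_of_ae_restrict_of_subset hK h)

theorem HasWeakDeriv.congr_left {n : ℕ} {v v' w : ℝ → ℝ} (h : HasWeakDeriv n v w)
    (hv : ∀ᵐ x ∂volume.restrict Lam, v x = v' x) : HasWeakDeriv n v' w := by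
  refine ⟨locallyIntegrableOn_Lam_congr h.1 hv, h.2.1, fun φ hφ hc hs => ?_⟩
  rw [← h.2.2 φ hφ hc hs]
  refine integral_congr_ae ?_
  filter_upwards [hv] with x hx
  rw [hx]

theorem HasWeakDeriv.ae_eq {n : ℕ} {v w w' : ℝ → ℝ} (h : HasWeakDeriv n v w)
    (h' : HasWeakDeriv n v w') : ∀ᵐ x ∂volume.restrict Lam, w x = w' x := by
  have := isOpen_Lam.ae_eq_zero_of_integral_contDiff_smul_eq_zero (h.2.1.sub h'.2.1)
    (μ := volume) fun φ hφ hc hs => by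
      have e1 := (h.2.2 φ hφ hc hs).symm.trans (h'.2.2 φ hφ hc hs)
      have e2 := mul_left_cancel₀ (pow_ne_zero n (by norm_num : (-1 : ℝ) ≠ 0)) e1
      have i1 := integrableOn_Lam_mul h.2.1 hφ.continuous hc hs
      have i2 := integrableOn_Lam_mul h'.2.1 hφ.continuous hc hs
      have e3 : ∫ x in Lam, (w x - w' x) * φ x = 0 := by
        simp only [sub_mul]
        rw [integral_sub i1 i2, e2, sub_self]
      rw [setIntegral_Lam_mul_of_tsupport_subset _ hs] at e3
      simpa [mul_comm] using e3
  rw [ae_restrict_iff' measurableSet_Lam]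
  filter_upwards [this] with x hx hx'
  exact sub_eq_zero.1 (hx hx')

theorem HasWeakDeriv.trans {l : ℕ} {v w w' : ℝ → ℝ} (h : HasWeakDeriv l v w)
    (h' : HasWeakDeriv 1 w w') : HasWeakDeriv (l + 1) v w' := by
  refine ⟨h.1, h'.2.1, fun φ hφ hc hs => ?_⟩
  have hφ' : ContDiff ℝ ∞ (deriv φ) := (contDiff_infty_iff_deriv.1 hφ).2
  have e := h'.2.2 φ hφ hc hs
  rw [iteratedDeriv_one] at e
  rw [iteratedDeriv_succ', h.2.2 _ hφ' hc.deriv (tsupport_deriv_subset.trans hs), e]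
  ring

theorem HasWeakDeriv.of_succ {l : ℕ} {v w w' : ℝ → ℝ} (h : HasWeakDeriv l v w)
    (h' : HasWeakDeriv (l + 1) v w') : HasWeakDeriv 1 w w' := by
  refine ⟨h.2.1, h'.2.1, fun φ hφ hc hs => ?_⟩
  have hφ' : ContDiff ℝ ∞ (deriv φ) := (contDiff_infty_iff_deriv.1 hφ).2
  have e := h'.2.2 φ hφ hc hs
  rw [iteratedDeriv_succ', h.2.2 _ hφ' hc.deriv (tsupport_deriv_subset.trans hs), pow_succ,
    mul_assoc] at e
  have := mul_left_cancel₀ (pow_ne_zero l (by norm_num : (-1 : ℝ) ≠ 0)) e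
  rw [iteratedDeriv_one, this, pow_one]

theorem hasWeakDeriv_zero {v : ℝ → ℝ} (hv : LocallyIntegrableOn v Lam) : HasWeakDeriv 0 v v :=
  ⟨hv, hv, fun φ _ _ _ => by simp⟩

theorem hasWeakDeriv_iterate_derivative (p : ℝ[X]) (n : ℕ) :
    HasWeakDeriv n (fun x => p.eval x) (fun x => (derivative^[n] p).eval x) := by
  induction n with
  | zero => exact hasWeakDeriv_zero (locallyIntegrableOn_of_continuous p.continuous _)
  | succ n ih =>
    rw [Function.iterate_succ_apply']
    exact ih.trans (hasWeakDeriv_derivative _)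

/-! ### Fractional integrals and derivatives of trial functions -/

/-- The fractional integral of a function that is integrable up to the right endpoint converges
absolutely almost everywhere. -/
theorem ae_integrableOn_mul_rpow {v : ℝ → ℝ} (hv : ∀ x ∈ Lam, IntegrableOn v (Set.Ioo x 1))
    {ρ : ℝ} (hρ : 0 < ρ) :
    ∀ᵐ x ∂volume.restrict Lam, IntegrableOn (fun y => v y * (y - x) ^ (ρ - 1)) (Set.Ioo x 1) := by
  -- `v` need not be integrable near `-1`, so `Λ` is exhausted by the intervals `(c n, 1)`; on each,
  -- the integral is a convolution of two `L¹` functions.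
  let c : ℕ → ℝ := fun n => -1 + 1 / ((n : ℝ) + 1)
  have hc (n : ℕ) : c n ∈ Lam := by
    have h1 : 0 < 1 / ((n : ℝ) + 1) := by positivity
    have h2 : 1 / ((n : ℝ) + 1) ≤ 1 := by
      rw [div_le_one (by positivity)]
      linarith [n.cast_nonneg (α := ℝ)]
    exact ⟨by simp only [c]; linarith, by simp only [c]; linarith⟩
  let g : ℝ → ℝ := fun t => (Set.Ioo (0 : ℝ) 2).indicator (fun t => t ^ (ρ - 1)) (-t)
  have hg : Integrable g := by
    refine Integrable.comp_neg (f := (Set.Ioo (0 : ℝ) 2).indicator (fun t => t ^ (ρ - 1))) ?_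
    rw [integrable_indicator_iff measurableSet_Ioo, ← intervalIntegrable_iff_integrableOn_Ioo_of_le
      (by norm_num)]
    exact intervalIntegral.intervalIntegrable_rpow' (by linarith)
  have key (n : ℕ) : ∀ᵐ x : ℝ, x ∈ Set.Ioo (c n) 1 →
      IntegrableOn (fun y => v y * (y - x) ^ (ρ - 1)) (Set.Ioo x 1) := by
    have hf : Integrable ((Set.Ioo (c n) 1).indicator v) :=
      (integrable_indicator_iff measurableSet_Ioo).2 (hv _ (hc n))
    filter_upwards [hf.ae_convolution_exists (ContinuousLinearMap.mul ℝ ℝ) hg] with x hx hxc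
    refine IntegrableOn.congr_fun (Integrable.integrableOn hx) (fun y hy => ?_) measurableSet_Ioo
    have hx1 := (hc n).1
    have h1 : y ∈ Set.Ioo (c n) 1 := ⟨hxc.1.trans hy.1, hy.2⟩
    have h2 : y - x ∈ Set.Ioo (0 : ℝ) 2 :=
      ⟨sub_pos.2 hy.1, by linarith [hy.2, hxc.1]⟩
    simp only [ContinuousLinearMap.mul_apply', g, neg_sub, Set.indicator_of_mem h1,
      Set.indicator_of_mem h2]
  rw [ae_restrict_iff' measurableSet_Lam]
  filter_upwards [ae_all_iff.2 key] with x hx hxL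
  obtain ⟨n, hn⟩ := exists_nat_one_div_lt (show 0 < x + 1 by linarith [hxL.1])
  exact hx n ⟨by simp only [c]; linarith, hxL.2⟩

theorem ae_rightInt_sub {u v : ℝ → ℝ} (hu : ∀ x ∈ Lam, IntegrableOn u (Set.Ioo x 1))
    (hv : ∀ x ∈ Lam, IntegrableOn v (Set.Ioo x 1)) {ρ : ℝ} (hρ : 0 < ρ) :
    ∀ᵐ x ∂volume.restrict Lam,
      rightInt ρ u x - rightInt ρ v x = rightInt ρ (fun y => u y - v y) x := by
  filter_upwards [ae_integrableOn_mul_rpow hu hρ, ae_integrableOn_mul_rpow hv hρ] with x h1 h2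
  simp only [rightInt, sub_mul]
  rw [integral_sub h1 h2, mul_sub]

/-- Fractional integration is known to be additive only where both integrals converge, that is
almost everywhere; weak derivatives ignore the exceptional null set. -/
theorem HasRightRL.sub {s : ℝ} {u v f g : ℝ → ℝ} (hu : HasRightRL s u f)
    (hv : HasRightRL s v g) :
    HasRightRL s (fun x => u x - v x) (fun x => f x - g x) := by
  refine ⟨fun x hx => (hu.1 x hx).sub (hv.1 x hx), ?_⟩
  have hρ : 0 < ((⌊s⌋₊ + 1 : ℕ) : ℝ) - s := by
    have := Nat.lt_floor_add_one s
    push_cast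
    linarith
  have := (hu.2.sub hv.2).congr_left (ae_rightInt_sub hu.1 hv.1 hρ)
  simpa only [mul_sub] using this

theorem integrableOn_rpow_mul_rpow {s ρ x : ℝ} (hs : 0 ≤ s) (hρ : 0 < ρ) (hx : x < 1) (j : ℕ) :
    IntegrableOn (fun y => (1 - y) ^ s * (1 - y) ^ j * (y - x) ^ (ρ - 1)) (Set.Ioo x 1) := by
  rw [← intervalIntegrable_iff_integrableOn_Ioo_of_le hx.le]
  have h1 : IntervalIntegrable (fun y : ℝ => (y - x) ^ (ρ - 1)) volume x 1 := by
    have := (intervalIntegral.intervalIntegrable_rpow' (a := 0) (b := 1 - x) (r := ρ - 1)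
      (by linarith)).comp_sub_right x
    simpa using this
  refine h1.continuousOn_mul (Continuous.continuousOn ?_)
  have : Continuous fun y : ℝ => (1 - y) ^ s := by
    refine Continuous.rpow_const (by fun_prop) fun _ => Or.inr hs
  fun_prop

/-- Scaling `y = x + (1 - x) t`: the powers of `1 - x` add up to the integer `k + j`. The remaining
Beta integral is only a constant and is never evaluated. -/
theorem integral_rpow_mul_rpow {s x : ℝ} (hx : x < 1) (k j : ℕ) :
    ∫ y in Set.Ioo x 1, (1 - y) ^ s * (1 - y) ^ j * (y - x) ^ ((k : ℝ) - s - 1) =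
      (1 - x) ^ (k + j) * ∫ t in (0 : ℝ)..1, (1 - t) ^ s * (1 - t) ^ j * t ^ ((k : ℝ) - s - 1) := by
  have hx0 : 0 < 1 - x := by linarith
  have h := intervalIntegral.integral_comp_mul_add (a := 0) (b := 1)
    (fun y => (1 - y) ^ s * (1 - y) ^ j * (y - x) ^ ((k : ℝ) - s - 1)) hx0.ne' x
  simp only [mul_zero, zero_add, mul_one, sub_add_cancel, smul_eq_mul] at h
  rw [← integral_Ioc_eq_integral_Ioo, ← intervalIntegral.integral_of_le hx.le]
  rw [eq_inv_mul_iff_mul_eq₀ hx0.ne'] at h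
  rw [← h, ← intervalIntegral.integral_const_mul, ← intervalIntegral.integral_const_mul]
  refine intervalIntegral.integral_congr fun t ht => ?_
  rw [Set.uIcc_of_le zero_le_one] at ht
  have e1 : 1 - ((1 - x) * t + x) = (1 - x) * (1 - t) := by ring
  have e2 : (1 - x) * t + x - x = (1 - x) * t := by ring
  have e3 : (1 - x) * ((1 - x) ^ s * (1 - x) ^ ((k : ℝ) - s - 1)) = (1 - x) ^ k := by
    rw [← Real.rpow_add hx0, ← Real.rpow_natCast]
    nth_rewrite 1 [← Real.rpow_one (1 - x)]
    rw [← Real.rpow_add hx0]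
    congr 1
    ring
  simp only [e1, e2]
  rw [Real.mul_rpow hx0.le (by linarith [ht.2]), Real.mul_rpow hx0.le ht.1, mul_pow, pow_add, ← e3]
  ring

theorem exists_rightInt_eq_eval {s : ℝ} {k : ℕ} (hs : 0 ≤ s) (hsk : s < k) {N : ℕ} {R : ℝ[X]}
    (hR : R.natDegree ≤ N) :
    ∃ P : ℝ[X], P.natDegree ≤ k + N ∧
      ∀ x < 1, rightInt (k - s) (fun y => (1 - y) ^ s * R.eval (1 - y)) x = P.eval x := by
  refine ⟨∑ j ∈ Finset.range (N + 1), C ((Real.Gamma (k - s))⁻¹ * (R.coeff j *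
    ∫ t in (0 : ℝ)..1, (1 - t) ^ s * (1 - t) ^ j * t ^ ((k : ℝ) - s - 1))) * (1 - X) ^ (k + j),
    ?_, fun x hx => ?_⟩
  · refine natDegree_sum_le_of_forall_le _ _ fun j hj => ?_
    have hj' : j ≤ N := Nat.lt_succ_iff.1 (Finset.mem_range.1 hj)
    have h1 : (1 - X : ℝ[X]).natDegree ≤ 1 := by
      refine (natDegree_sub_le _ _).trans ?_
      simp
    calc _ ≤ ((1 - X : ℝ[X]) ^ (k + j)).natDegree := natDegree_C_mul_le _ _
      _ ≤ (k + j) * 1 := natDegree_pow_le_of_le _ h1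
      _ ≤ k + N := by omega
  · have e : ∀ y : ℝ, (1 - y) ^ s * R.eval (1 - y) * (y - x) ^ ((k : ℝ) - s - 1) =
        ∑ j ∈ Finset.range (N + 1),
          R.coeff j * ((1 - y) ^ s * (1 - y) ^ j * (y - x) ^ ((k : ℝ) - s - 1)) := by
      intro y
      rw [eval_eq_sum_range' (Nat.lt_succ_of_le hR), Finset.mul_sum, Finset.sum_mul]
      exact Finset.sum_congr rfl fun j _ => by ring
    simp only [rightInt, e]
    rw [integral_finsetSum _ fun j _ =>
      (integrableOn_rpow_mul_rpow hs (by linarith) hx j).const_mul _, Finset.mul_sum,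
      eval_finsetSum]
    refine Finset.sum_congr rfl fun j _ => ?_
    rw [integral_const_mul, integral_rpow_mul_rpow hx]
    simp only [eval_mul, eval_C, eval_pow, eval_sub, eval_one, eval_X]
    ring

theorem exists_polynomial_of_mem_trialSpace {s : ℝ} {N : ℕ} {w : ℝ → ℝ}
    (hw : w ∈ trialSpace s N) :
    ∃ R : ℝ[X], R.natDegree ≤ N ∧ w = fun x => (1 - x) ^ s * R.eval (1 - x) := by
  induction hw using Submodule.span_induction with
  | mem w hw =>
    obtain ⟨n, hn, rfl⟩ := hw
    refine ⟨∑ j ∈ Finset.range (n + 1),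
      C ((ascPochhammer ℝ j).eval (n + s + -s + 1) * (ascPochhammer ℝ (n - j)).eval (s + j + 1) /
        (j.factorial * (n - j).factorial)) * (C (-1 / 2) * X) ^ j, ?_, ?_⟩
    · refine natDegree_sum_le_of_forall_le _ _ fun j hj => ?_
      have hj' : j ≤ n := Nat.lt_succ_iff.1 (Finset.mem_range.1 hj)
      calc _ ≤ ((C (-1 / 2) * X : ℝ[X]) ^ j).natDegree := natDegree_C_mul_le _ _
        _ ≤ j * 1 := natDegree_pow_le_of_le _ ((natDegree_C_mul_le _ _).trans natDegree_X_le)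
        _ ≤ N := by omega
    · ext x
      simp only [gjf, jacobiP, eval_finsetSum, eval_mul, eval_C, eval_pow, eval_X]
      congr 1
      refine Finset.sum_congr rfl fun j _ => ?_
      congr 2
      ring
  | zero => exact ⟨0, by simp, by ext; simp⟩
  | add v w _ _ hv hw =>
    obtain ⟨R, hR, rfl⟩ := hv
    obtain ⟨S, hS, rfl⟩ := hw
    refine ⟨R + S, (natDegree_add_le _ _).trans (max_le hR hS), ?_⟩
    ext x
    simp [mul_add]
  | smul c w _ hw =>
    obtain ⟨R, hR, rfl⟩ := hw
    refine ⟨c • R, (natDegree_smul_le _ _).trans hR, ?_⟩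
    ext x
    simp only [Pi.smul_apply, smul_eq_mul, eval_smul]
    ring

/-- The fractional derivative of a trial function is a polynomial of degree at most `N`. -/
theorem exists_polynomial_of_hasRightRL {s : ℝ} (hs : 0 ≤ s) {N : ℕ} {w g : ℝ → ℝ}
    (hw : w ∈ trialSpace s N) (hg : HasRightRL s w g) :
    ∃ p : ℝ[X], p.natDegree ≤ N ∧ ∀ᵐ x ∂volume.restrict Lam, g x = p.eval x := by
  obtain ⟨R, hR, rfl⟩ := exists_polynomial_of_mem_trialSpace hw
  have hsk : s < (⌊s⌋₊ + 1 : ℕ) := by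
    push_cast
    exact Nat.lt_floor_add_one s
  obtain ⟨hg1, hg2⟩ := hg
  generalize ⌊s⌋₊ + 1 = k at hg2 hsk
  obtain ⟨P, hP, hPx⟩ := exists_rightInt_eq_eval hs hsk hR
  have h1 := hg2.congr_left (v' := fun x => P.eval x) (by
    filter_upwards [ae_restrict_mem measurableSet_Lam] with x hx
    exact hPx x hx.2)
  refine ⟨C ((-1) ^ k) * derivative^[k] P, ?_, ?_⟩
  · have := natDegree_iterate_derivative P k
    exact (natDegree_C_mul_le _ _).trans (by omega)
  · filter_upwards [h1.ae_eq (hasWeakDeriv_iterate_derivative P k)] with x hx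
    rw [eval_mul, eval_C, ← hx, ← mul_assoc, ← mul_pow]
    norm_num

/-! ### Error of the orthogonal projection -/

theorem natDegree_weightedDeriv_le (a : ℕ) (r : ℝ[X]) :
    (weightedDeriv a r).natDegree ≤ r.natDegree + 1 := by
  rw [natDegree_le_iff_coeff_eq_zero]
  intro j hj
  have h0 (i : ℕ) (hi : r.natDegree < i) : r.coeff i = 0 := coeff_eq_zero_of_natDegree_lt hi
  obtain ⟨j, rfl⟩ : ∃ i, j = i + 1 := ⟨j - 1, by omega⟩
  rw [weightedDeriv, sub_mul, one_mul, mul_assoc]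
  generalize (2 * (a + 1) : ℝ) = c
  rcases j with _ | j
  · omega
  · simp [coeff_derivative, coeff_X_pow_mul', h0 (j + 1) (by omega),
      h0 (j + 1 + 1 + 1) (by omega)]

/-- If `h 0` is orthogonal to the polynomials of degree at most `N`, its `l`-th derivative is
orthogonal to those of degree at most `N - l` in the weighted space. -/
theorem orthogonal_weakDeriv {m N : ℕ} {h : ℕ → ℝ → ℝ} (hmN : m ≤ N)
    (hw : ∀ l < m, HasWeakDeriv 1 (h l) (h (l + 1)))
    (hm : ∀ l ≤ m, MemLp (h l) 2 (jacobiMeasure l))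
    (horth : ∀ r : ℝ[X], r.natDegree ≤ N → ∫ x, h 0 x * r.eval x ∂jacobiMeasure 0 = 0) :
    ∀ l ≤ m, ∀ r : ℝ[X], r.natDegree ≤ N - l →
      ∫ x, h l x * r.eval x ∂jacobiMeasure l = 0 := by
  intro l
  induction l with
  | zero => exact fun _ => horth
  | succ l ih =>
    intro hl r hr
    have h1 := integral_mul_weightedDeriv (hw l hl) (hm l (by omega)) (hm (l + 1) hl) r
    rw [ih (by omega) _ ((natDegree_weightedDeriv_le l r).trans (by omega))] at h1
    linarith

theorem factorial_mul_integral_sq_le {m N : ℕ} {h : ℕ → ℝ → ℝ} (hmN : m ≤ N)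
    (hw : ∀ l < m, HasWeakDeriv 1 (h l) (h (l + 1)))
    (hm : ∀ l ≤ m, MemLp (h l) 2 (jacobiMeasure l))
    (horth : ∀ r : ℝ[X], r.natDegree ≤ N → ∫ x, h 0 x * r.eval x ∂jacobiMeasure 0 = 0) :
    ∀ l ≤ m, (N : ℝ) ^ l * (N + 1).factorial * ∫ x, h 0 x ^ 2 ∂jacobiMeasure 0 ≤
      (N - l + 1).factorial * ∫ x, h l x ^ 2 ∂jacobiMeasure l := by
  intro l
  induction l with
  | zero => intro _; simp
  | succ l ih =>
    intro hl
    -- With `n = N - l` and `a = l` the constant is `(N - l + 1) (N + l + 2)`: the first factor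
    -- advances the factorial, the second is bounded below by `N`.
    have h1 := integral_sq_le_of_orthogonal (n := N - l) (hw l hl) (hm l (by omega))
      (hm (l + 1) hl) (orthogonal_weakDeriv hmN hw hm horth l (by omega))
    have h2 := ih (by omega)
    have h3 : (N : ℝ) = ((N - l : ℕ) : ℝ) + l := by
      rw [Nat.cast_sub (by omega)]
      ring
    rw [show N - (l + 1) + 1 = N - l by omega]
    rw [Nat.factorial_succ (N - l)] at h2
    push_cast at h2
    have hE : 0 ≤ ∫ x, h l x ^ 2 ∂jacobiMeasure l := integral_nonneg fun x => sq_nonneg _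
    generalize ∫ x, h l x ^ 2 ∂jacobiMeasure l = E at *
    generalize ∫ x, h (l + 1) x ^ 2 ∂jacobiMeasure (l + 1) = E' at *
    calc (N : ℝ) ^ (l + 1) * (N + 1).factorial * ∫ x, h 0 x ^ 2 ∂jacobiMeasure 0
        = N * ((N : ℝ) ^ l * (N + 1).factorial * ∫ x, h 0 x ^ 2 ∂jacobiMeasure 0) := by ring
      _ ≤ N * ((((N - l : ℕ) : ℝ) + 1) * (N - l).factorial * E) := by gcongr
      _ ≤ (((N - l : ℕ) : ℝ) + 2 * l + 2) * ((((N - l : ℕ) : ℝ) + 1) * (N - l).factorial * E) := by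
          gcongr
          rw [h3]
          linarith [l.cast_nonneg (α := ℝ)]
      _ = (N - l).factorial * ((((N - l : ℕ) : ℝ) + 1) * (((N - l : ℕ) : ℝ) + 2 * l + 2) * E) := by
          ring
      _ ≤ (N - l).factorial * E' := by gcongr

/-- The error of the best polynomial approximation in `L²(Λ)`. -/
theorem integral_sq_sub_eval_le {m N : ℕ} (hmN : m ≤ N) {df : ℕ → ℝ → ℝ} {p : ℝ[X]}
    (hp : p.natDegree ≤ N) (hw : ∀ l < m, HasWeakDeriv 1 (df l) (df (l + 1)))
    (hm : ∀ l ≤ m, MemLp (df l) 2 (jacobiMeasure l))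
    (horth : ∀ r : ℝ[X], r.natDegree ≤ N →
      ∫ x, (df 0 x - p.eval x) * r.eval x ∂jacobiMeasure 0 = 0) :
    (N : ℝ) ^ m * (N + 1).factorial * ∫ x, (df 0 x - p.eval x) ^ 2 ∂jacobiMeasure 0 ≤
      (N - m + 1).factorial * ∫ x, df m x ^ 2 ∂jacobiMeasure m := by
  have hw' : ∀ l < m, HasWeakDeriv 1 (fun x => df l x - (derivative^[l] p).eval x)
      (fun x => df (l + 1) x - (derivative^[l + 1] p).eval x) := fun l hl => by
    rw [Function.iterate_succ_apply']
    exact (hw l hl).sub (hasWeakDeriv_derivative _)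
  have hm' : ∀ l ≤ m, MemLp (fun x => df l x - (derivative^[l] p).eval x) 2 (jacobiMeasure l) :=
    fun l hl => (hm l hl).sub (memLp_eval l _)
  have h1 := factorial_mul_integral_sq_le
    (h := fun l x => df l x - (derivative^[l] p).eval x) hmN hw' hm' horth m le_rfl
  -- `p^(m)` has degree at most `N - m`, so Pythagoras lets it be dropped from `‖f^(m) - p^(m)‖`.
  have h2 := orthogonal_weakDeriv
    (h := fun l x => df l x - (derivative^[l] p).eval x) hmN hw' hm' horth m le_rfl
    (derivative^[m] p) ((natDegree_iterate_derivative p m).trans (by omega))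
  refine h1.trans ?_
  rw [integral_sub_eval_sq (hm m le_rfl) h2]
  have := polyForm_self_nonneg m (derivative^[m] p)
  gcongr
  linarith

/-! ### From the factorial bound to a pure power of `N` -/

theorem pow_mul_factorial_le {m N : ℕ} (hmN : m ≤ N) :
    ∀ l ≤ m, N ^ l * (N - l + 1).factorial ≤ (m + 1) ^ l * (N + 1).factorial := by
  intro l
  induction l with
  | zero => simp
  | succ l ih =>
    intro hl
    have h1 : N ≤ (m + 1) * (N - l + 1) := by
      obtain ⟨t, rfl⟩ : ∃ t, N = l + t := ⟨N - l, by omega⟩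
      rw [Nat.add_sub_cancel_left]
      nlinarith
    rw [show N - (l + 1) + 1 = N - l by omega]
    calc N ^ (l + 1) * (N - l).factorial = N ^ l * (N * (N - l).factorial) := by ring
      _ ≤ N ^ l * ((m + 1) * (N - l + 1) * (N - l).factorial) := by gcongr
      _ = (m + 1) * (N ^ l * (N - l + 1).factorial) := by rw [Nat.factorial_succ]; ring
      _ ≤ (m + 1) * ((m + 1) ^ l * (N + 1).factorial) := Nat.mul_le_mul_left _ (ih (by omega))
      _ = (m + 1) ^ (l + 1) * (N + 1).factorial := by ring

/-- If `N = 0` then `m = 0` and the power is `0 ^ 0 = 1`, so dividing by it is always legitimate. -/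
theorem natCast_pow_pos {m N : ℕ} (hmN : m ≤ N) : 0 < (N : ℝ) ^ m := by
  rcases Nat.eq_zero_or_pos N with h | h
  · obtain rfl : m = 0 := by omega
    simp
  · positivity

theorem rpow_neg_half_sq {m N : ℕ} : ((N : ℝ) ^ (-(m : ℝ) / 2)) ^ 2 = ((N : ℝ) ^ m)⁻¹ := by
  rw [← Real.rpow_natCast _ 2, ← Real.rpow_mul N.cast_nonneg]
  push_cast
  rw [div_mul_cancel₀ _ (two_ne_zero), Real.rpow_neg N.cast_nonneg, Real.rpow_natCast]

theorem rpow_mul_sqrt_factorial_le {m N : ℕ} (hmN : m ≤ N) :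
    (N : ℝ) ^ (-(m : ℝ) / 2) *
        Real.sqrt (((N - m + 1).factorial : ℝ) / ((N + 1).factorial : ℝ)) ≤
      ((m : ℝ) + 1) ^ m * (N : ℝ) ^ (-(m : ℤ)) := by
  refine (sq_le_sq₀ (by positivity) (by positivity)).1 ?_
  rw [mul_pow, rpow_neg_half_sq, Real.sq_sqrt (by positivity), mul_pow, zpow_neg, zpow_natCast]
  have hN := natCast_pow_pos hmN
  have h1 : (N : ℝ) ^ m * (N - m + 1).factorial ≤ ((m : ℝ) + 1) ^ m * (N + 1).factorial := by
    exact_mod_cast pow_mul_factorial_le hmN m le_rfl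
  have h2 : (1 : ℝ) ≤ ((m : ℝ) + 1) ^ m := one_le_pow₀ (by linarith [m.cast_nonneg (α := ℝ)])
  have hF : (0 : ℝ) < (N + 1).factorial := by positivity
  generalize (N : ℝ) ^ m = A at *
  generalize ((m : ℝ) + 1) ^ m = B at *
  rw [inv_pow, ← div_eq_mul_inv, le_div_iff₀ (by positivity), inv_mul_eq_div, div_div,
    div_mul_eq_mul_div, div_le_iff₀ (by positivity)]
  -- After squaring, `B` would suffice where `B ^ 2` is allowed; `B ≥ 1` bridges the two.
  nlinarith [mul_pos hN hF, mul_le_mul_of_nonneg_left h1 hN.le,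
    mul_nonneg (mul_nonneg (by linarith : 0 ≤ B) (sub_nonneg.2 h2)) (mul_pos hN hF).le]

theorem memL2_zero_iff (v : ℝ → ℝ) : MemL2 0 0 v ↔ MemLp v 2 (jacobiMeasure 0) := by
  simpa only [Nat.cast_zero] using memL2_iff 0 v

theorem normL2_zero (v : ℝ → ℝ) :
    normL2 0 0 v = Real.sqrt (∫ x, v x ^ 2 ∂jacobiMeasure 0) := by
  simpa only [Nat.cast_zero] using normL2_natCast 0 v

end GJF

/-! ### The error estimate -/

theorem theorem5p1 :
    ∃ c : ℕ → ℝ, (∀ m, 0 < c m) ∧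
      ∀ (k : ℕ) (s : ℝ), 1 ≤ k → (k : ℝ) - 1 < s → s < k →
      ∀ (m N : ℕ), m ≤ N →
      ∀ (f : ℝ → ℝ) (df : ℕ → ℝ → ℝ),
        GJF.MemL2 0 0 f →
        (∀ l ≤ m, GJF.HasWeakDeriv l f (df l) ∧ GJF.MemL2 l l (df l)) →
      ∀ u uN : ℝ → ℝ, GJF.IsSolution k s f u → GJF.IsGalerkin s N f uN →
        ∃ e : ℝ → ℝ, GJF.HasRightRL s (fun x => u x - uN x) e ∧ GJF.MemL2 0 0 e ∧
          GJF.normL2 0 0 e ≤ c m * (N : ℝ) ^ (-(m : ℤ)) * GJF.normL2 m m (df m) ∧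
          GJF.normL2 0 0 e ≤
            (N : ℝ) ^ (-(m : ℝ) / 2) *
              Real.sqrt (((N - m + 1).factorial : ℝ) / ((N + 1).factorial : ℝ)) *
              GJF.normL2 m m (df m) := by
  refine ⟨fun m => ((m : ℝ) + 1) ^ m, fun m => by positivity, ?_⟩
  intro k s hk hks _ m N hmN f df hf hdf u uN hu ⟨huN, g, hg, hg2, hgal⟩
  have hs : 0 ≤ s := by
    have : (1 : ℝ) ≤ k := by exact_mod_cast hk
    linarith
  obtain ⟨p, hp, hgp⟩ := GJF.exists_polynomial_of_hasRightRL hs huN hg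
  rw [GJF.memL2_zero_iff] at hf hg2
  -- The weak derivative of order zero agrees with `f` only almost everywhere, so `df 0` and `f`
  -- have to be identified.
  have hfd := (hdf 0 (by omega)).1
  have hff : ∀ᵐ x ∂volume.restrict GJF.Lam, f x = df 0 x :=
    (GJF.hasWeakDeriv_zero hfd.1).ae_eq hfd
  have he : ∀ᵐ x ∂GJF.jacobiMeasure 0, f x - g x = df 0 x - p.eval x := by
    rw [GJF.ae_jacobiMeasure_iff]
    filter_upwards [hff, hgp] with x h1 h2
    rw [h1, h2]
  have horth : ∀ r : Polynomial ℝ, r.natDegree ≤ N →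
      ∫ x, (df 0 x - p.eval x) * r.eval x ∂GJF.jacobiMeasure 0 = 0 := fun r hr => by
    have h1 := hgal r hr
    have h2 (v : ℝ → ℝ) : ∫ x, v x ∂GJF.jacobiMeasure 0 = ∫ x in GJF.Lam, v x := by
      simp [GJF.integral_jacobiMeasure]
    rw [← h2, ← h2] at h1
    calc ∫ x, (df 0 x - p.eval x) * r.eval x ∂GJF.jacobiMeasure 0
        = ∫ x, (f x * r.eval x - g x * r.eval x) ∂GJF.jacobiMeasure 0 := by
          refine integral_congr_ae ?_
          filter_upwards [he] with x hx
          rw [← hx, sub_mul]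
      _ = 0 := by
          rw [integral_sub (GJF.integrable_mul_eval hf r) (GJF.integrable_mul_eval hg2 r), h1,
            sub_self]
  have hbound := GJF.integral_sq_sub_eval_le hmN hp
    (fun l hl => (hdf l (by omega)).1.of_succ (hdf (l + 1) hl).1)
    (fun l hl => (GJF.memL2_iff l _).1 (hdf l hl).2) horth
  have hnorm : GJF.normL2 0 0 (fun x => f x - g x) ≤ (N : ℝ) ^ (-(m : ℝ) / 2) *
      Real.sqrt (((N - m + 1).factorial : ℝ) / ((N + 1).factorial : ℝ)) *
      GJF.normL2 m m (df m) := by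
    rw [GJF.normL2_zero, GJF.normL2_natCast]
    refine Real.sqrt_le_iff.2 ⟨by positivity, ?_⟩
    have hF : 0 ≤ ∫ x, df m x ^ 2 ∂GJF.jacobiMeasure m := integral_nonneg fun x => sq_nonneg _
    rw [mul_pow, mul_pow, GJF.rpow_neg_half_sq, Real.sq_sqrt (by positivity), Real.sq_sqrt hF]
    rw [show ∫ x, (f x - g x) ^ 2 ∂GJF.jacobiMeasure 0 =
        ∫ x, (df 0 x - p.eval x) ^ 2 ∂GJF.jacobiMeasure 0 from integral_congr_ae (by
          filter_upwards [he] with x hx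
          rw [hx])]
    have hN := GJF.natCast_pow_pos hmN
    rw [inv_mul_eq_div, div_div, div_mul_eq_mul_div, le_div_iff₀ (by positivity)]
    linarith
  refine ⟨fun x => f x - g x, hu.1.sub hg, ?_, ?_, hnorm⟩
  · rw [GJF.memL2_zero_iff]
    exact hf.sub hg2
  · exact hnorm.trans (mul_le_mul_of_nonneg_right (GJF.rpow_mul_sqrt_factorial_le hmN)
      (Real.sqrt_nonneg _))
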